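/- Call a nonempty set $C \subseteq \mathbb{F}^n$ ($\mathbb{F} = \mathbb{R}$ or $\mathbb{C}$) an invariant closed convex set of an $n \times n$ matrix $T$ over $\mathbb{F}$ if $C$ is closed, convex (that is, $(1-t)x + ty \in C$ for all $x, y \in C$ and real $t \in [0,1]$), and $T(C) \subseteq C$. An invariant subspace of $T$ is an $\mathbb{F}$-linear subspace $M$ of $\mathbb{F}^n$ with $T(M) \subseteq M$. Let $\overline{\mathbb{D}} = \{z \in \mathbb{C} : |z| \le 1\}$ and $\mathbb{R}^+ = (0,\infty)$. Complex case: let $T$ be a complex $n \times n$ matrix with eigenvalues $\lambda_1, \dots, \lambda_n$. Every invariant closed convex set of $T$ in $\mathbb{C}^n$ is an invariant subspace of $T$ if and only if all $\lambda_k$ lie in $\mathbb{C} \setminus (\overline{\mathbb{D}} \cup \mathbb{R})$ and $\lambda_j \neq \overline{\lambda_k}$ for all $1 \le j, k \le n$. Real case: let $T$ be a real $n \times n$ matrix. Every invariant closed convex set of $T$ in $\mathbb{R}^n$ is an invariant subspace of $T$ if and only if all the (real and complex) eigenvalues of $T$ lie in $\mathbb{C} \setminus (\overline{\mathbb{D}}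 \cup \mathbb{R}^+)$. -/

import Mathlib

/-- `C` is a nonempty closed convex subset of `𝕜ⁿ` (convex over the reals, also for `𝕜 = ℂ`)
with `T(C) ⊆ C`. -/
def IsInvariantClosedConvex {𝕜 : Type*} [RCLike 𝕜] {n : ℕ}
    (T : Matrix (Fin n) (Fin n) 𝕜) (C : Set (Fin n → 𝕜)) : Prop :=
  C.Nonempty ∧ IsClosed C ∧ Convex ℝ C ∧ Set.MapsTo (fun x => T.mulVec x) C C

/-- `C` is a `𝕜`-linear subspace of `𝕜ⁿ` with `T(C) ⊆ C`. -/
def IsInvariantSubspace {𝕜 : Type*} [RCLike 𝕜] {n : ℕ}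
    (T : Matrix (Fin n) (Fin n) 𝕜) (C : Set (Fin n → 𝕜)) : Prop :=
  (∃ M : Submodule 𝕜 (Fin n → 𝕜), (M : Set (Fin n → 𝕜)) = C) ∧
    Set.MapsTo (fun x => T.mulVec x) C C

/-- `μ` is an eigenvalue of the complex matrix `T`. -/
def IsEigenvalueOf {n : ℕ} (T : Matrix (Fin n) (Fin n) ℂ) (μ : ℂ) : Prop :=
  Module.End.HasEigenvalue (Matrix.toLin' T) μ

/-!
Sufficiency. Suppose that the eigenvalues of `T` avoid the closed unit disc and the positive real
axis. Each eigenvalue `z` has a power with nonpositive real part, so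
`(X ^ k - z ^ k) * (X ^ k - conj z ^ k)` has nonnegative coefficients for a suitable `k`. The
product of these polynomials has nonnegative coefficients and positive constant term, and it
annihilates `T` by Cayley–Hamilton (`exists_nonneg_coeff_aeval_eq_zero`). Applied to a point `x`
of an invariant convex set `C`, this relation gives `0 ∈ C` and `-ε • x ∈ C` for some `ε > 0`.
Hence `C` absorbs its real span `W`, and contains a neighbourhood of `0` in `W` because `W` is
finite-dimensional. Since the eigenvalues of `T⁻¹` lie in the open unit disc, `T⁻¹ ^ k • w → 0` for
each `w ∈ W` (`tendsto_inv_pow_mulVec`), so `T⁻¹ ^ k • w` enters `C` and `w = T ^ k • T⁻¹ ^ k • w`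
lies in `C`. Thus `C = W` (`span_eq_of_convex_of_mapsTo`), which settles the real case. In the
complex case, the absence of conjugate pairs of eigenvalues makes multiplication by `I` a real
polynomial in `T` (`exists_aeval_eq_I`), so the real subspace `C` is a complex one.

Necessity. Each forbidden eigenvalue yields an explicit invariant closed convex set that is not a
subspace: the image of a disc, a ray, a real line, or a real plane spanned by eigenvectors for
two conjugate eigenvalues.
-/

open Polynomial Filter Topology

/-! ### Annihilating polynomials with nonnegative coefficients -/

/-- A complex number off the positive real axis has a positive power in the closed left
half-plane: some multiple of its argument falls between `π / 2` and `3 * π / 2`. -/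
lemma exists_pow_re_nonpos {z : ℂ} (hz : ∀ r : ℝ, 0 < r → (r : ℂ) ≠ z) :
    ∃ k : ℕ, 0 < k ∧ (z ^ k).re ≤ 0 := by
  by_cases h0 : z = 0
  · exact ⟨1, one_pos, by simp [h0]⟩
  have hθ : 0 < |z.arg| := by
    refine abs_pos.2 fun h => ?_
    refine hz ‖z‖ (norm_pos_iff.2 h0) ?_
    have := Complex.norm_mul_exp_arg_mul_I z
    simpa [h] using this
  set θ := |z.arg| with hθdef
  have hre : ∀ k : ℕ, (z ^ k).re = ‖z‖ ^ k * Real.cos (k * θ) := by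
    intro k
    have h1 : Real.cos (k * θ) = Real.cos (k * z.arg) := by
      rw [← Real.cos_abs (k * z.arg), abs_mul, Nat.abs_cast]
    conv_lhs => rw [← Complex.norm_mul_exp_arg_mul_I z, mul_pow, ← Complex.exp_nat_mul,
      ← Complex.ofReal_pow, Complex.re_ofReal_mul, ← mul_assoc]
    rw [h1, ← Complex.exp_ofReal_mul_I_re]
    push_cast
    rfl
  have hpos : 0 < Real.pi / 2 / θ := by positivity
  refine ⟨⌈Real.pi / 2 / θ⌉₊, Nat.ceil_pos.2 hpos, ?_⟩
  rw [hre]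
  refine mul_nonpos_of_nonneg_of_nonpos (by positivity)
    (Real.cos_nonpos_of_pi_div_two_le_of_le ?_ ?_)
  · exact (div_le_iff₀ hθ).1 (Nat.le_ceil _)
  · have h1 := mul_le_mul_of_nonneg_right (Nat.ceil_lt_add_one hpos.le).le hθ.le
    rw [add_mul, div_mul_cancel₀ _ hθ.ne', one_mul] at h1
    linarith [Complex.abs_arg_le_pi z]

/-- The real polynomial `(X ^ k - z ^ k) * (X ^ k - conj z ^ k)`, with `k` chosen so that
`z ^ k` has nonpositive real part, has nonnegative coefficients. -/
lemma exists_nonneg_coeff_dvd_of_root {z : ℂ} (h0 : z ≠ 0)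
    (hz : ∀ r : ℝ, 0 < r → (r : ℂ) ≠ z) :
    ∃ P : ℝ[X], (∀ i, 0 ≤ P.coeff i) ∧ 0 < P.coeff 0 ∧
      (X - C z) ∣ P.map (algebraMap ℝ ℂ) := by
  obtain ⟨k, hk, hre⟩ := exists_pow_re_nonpos hz
  refine ⟨X ^ (2 * k) + C (-(2 * (z ^ k).re)) * X ^ k + C (Complex.normSq (z ^ k)), ?_, ?_, ?_⟩
  · intro i
    have h1 : 0 ≤ (X ^ (2 * k) : ℝ[X]).coeff i := by rw [coeff_X_pow]; split_ifs <;> norm_num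
    have h2 : 0 ≤ (C (-(2 * (z ^ k).re)) * X ^ k : ℝ[X]).coeff i := by
      rw [coeff_C_mul_X_pow]; split_ifs <;> linarith
    have h3 : 0 ≤ (C (Complex.normSq (z ^ k)) : ℝ[X]).coeff i := by
      rw [coeff_C]; split_ifs
      · exact Complex.normSq_nonneg _
      · exact le_rfl
    simp only [coeff_add]
    linarith
  · have h2 : (2 * k) ≠ 0 := by omega
    simp only [coeff_add, coeff_X_pow, coeff_C_mul_X_pow, coeff_C_zero, hk.ne, h2.symm, if_false,
      zero_add]
    exact Complex.normSq_pos.2 (pow_ne_zero _ h0)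
  · have hfac : (X ^ (2 * k) + C (-(2 * (z ^ k).re)) * X ^ k
        + C (Complex.normSq (z ^ k)) : ℝ[X]).map (algebraMap ℝ ℂ)
        = (X ^ k - C z ^ k) * (X ^ k - C ((starRingEnd ℂ) (z ^ k))) := by
      have hs : z ^ k + (starRingEnd ℂ) (z ^ k) = ((2 * (z ^ k).re : ℝ) : ℂ) := Complex.add_conj _
      have hp : z ^ k * (starRingEnd ℂ) (z ^ k) = (Complex.normSq (z ^ k) : ℂ) :=
        Complex.mul_conj _
      simp only [Polynomial.map_add, Polynomial.map_mul, Polynomial.map_pow, map_X, map_C,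
        Complex.coe_algebraMap, Complex.ofReal_neg]
      rw [← hs, ← hp, ← C_pow]
      simp only [C_neg, C_add, C_mul]
      ring
    rw [hfac]
    exact (sub_dvd_pow_sub_pow _ _ k).mul_right _

/-- A finite product of linear factors whose roots avoid `[0, ∞)` divides a real polynomial
with nonnegative coefficients and positive constant term. -/
lemma exists_nonneg_coeff_dvd (s : Multiset ℂ) (h0 : ∀ z ∈ s, z ≠ 0)
    (hs : ∀ z ∈ s, ∀ r : ℝ, 0 < r → (r : ℂ) ≠ z) :
    ∃ P : ℝ[X], (∀ i, 0 ≤ P.coeff i) ∧ 0 < P.coeff 0 ∧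
      (s.map fun z => X - C z).prod ∣ P.map (algebraMap ℝ ℂ) := by
  induction s using Multiset.induction_on with
  | empty =>
    refine ⟨1, fun i => ?_, by simp, by simp⟩
    rw [coeff_one]; split_ifs <;> norm_num
  | cons z s ih =>
    obtain ⟨P, hP, hP0, hPd⟩ := ih (fun w hw => h0 w (Multiset.mem_cons_of_mem hw))
      (fun w hw => hs w (Multiset.mem_cons_of_mem hw))
    obtain ⟨Q, hQ, hQ0, hQd⟩ := exists_nonneg_coeff_dvd_of_root
      (h0 z (Multiset.mem_cons_self z s)) (hs z (Multiset.mem_cons_self z s))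
    refine ⟨Q * P, fun i => ?_, ?_, ?_⟩
    · rw [coeff_mul]
      exact Finset.sum_nonneg fun x _ => mul_nonneg (hQ _) (hP _)
    · rw [mul_coeff_zero]
      exact mul_pos hQ0 hP0
    · rw [Multiset.map_cons, Multiset.prod_cons, Polynomial.map_mul]
      exact mul_dvd_mul hQd hPd

lemma isEigenvalueOf_iff_mem_spectrum {n : ℕ} {T : Matrix (Fin n) (Fin n) ℂ} {μ : ℂ} :
    IsEigenvalueOf T μ ↔ μ ∈ spectrum ℂ T := by
  rw [IsEigenvalueOf, Module.End.hasEigenvalue_iff_mem_spectrum, Matrix.spectrum_toLin']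

/-- By Cayley–Hamilton, the polynomial of `exists_nonneg_coeff_dvd` for the roots of the
characteristic polynomial annihilates `T`. -/
lemma exists_nonneg_coeff_aeval_eq_zero {n : ℕ} {T : Matrix (Fin n) (Fin n) ℂ}
    (h0 : ∀ z ∈ spectrum ℂ T, z ≠ 0)
    (hT : ∀ z ∈ spectrum ℂ T, ∀ r : ℝ, 0 < r → (r : ℂ) ≠ z) :
    ∃ P : ℝ[X], (∀ i, 0 ≤ P.coeff i) ∧ 0 < P.coeff 0 ∧ aeval T P = 0 := by
  have hroot : ∀ z ∈ T.charpoly.roots, z ∈ spectrum ℂ T := fun z hz =>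
    Matrix.mem_spectrum_iff_isRoot_charpoly.2 (isRoot_of_mem_roots hz)
  obtain ⟨P, hP, hP0, hd⟩ := exists_nonneg_coeff_dvd T.charpoly.roots
    (fun z hz => h0 z (hroot z hz)) (fun z hz => hT z (hroot z hz))
  rw [← (IsAlgClosed.splits T.charpoly).eq_prod_roots_of_monic T.charpoly_monic] at hd
  refine ⟨P, hP, hP0, ?_⟩
  obtain ⟨q, hq⟩ := hd
  rw [← aeval_map_algebraMap ℂ, hq, map_mul, Matrix.aeval_self_charpoly, zero_mul]

/-! ### Negative powers of an expanding matrix -/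

section
attribute [local instance] Matrix.linftyOpNormedRing Matrix.linftyOpNormedAlgebra

/-- If all eigenvalues of `T` have modulus greater than one, then the negative powers of `T`
tend to zero, by Gelfand's formula for `T⁻¹`. -/
lemma tendsto_inv_pow_mulVec {n : ℕ} {T : Matrix (Fin n) (Fin n) ℂ}
    (hT : ∀ z ∈ spectrum ℂ T, 1 < ‖z‖) (v : Fin n → ℂ) :
    Tendsto (fun k : ℕ => (T⁻¹ ^ k).mulVec v) atTop (𝓝 0) := by
  obtain hn | hn := isEmpty_or_nonempty (Fin n)
  · exact tendsto_const_nhds.congr fun k => Subsingleton.elim _ _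
  have hu : IsUnit T := by
    rw [← spectrum.zero_notMem_iff ℂ]
    intro h
    have := hT 0 h
    norm_num at this
  obtain ⟨U, rfl⟩ := hu
  rw [← Matrix.coe_units_inv]
  have hr : spectralRadius ℂ ((U⁻¹ : (Matrix (Fin n) (Fin n) ℂ)ˣ) : Matrix (Fin n) (Fin n) ℂ)
      < (1 : NNReal) := by
    refine spectrum.spectralRadius_lt_of_forall_lt _ fun z hz => ?_
    rw [← spectrum.map_inv, Set.mem_inv] at hz
    have h1 := hT _ hz
    rw [norm_inv] at h1
    rw [← NNReal.coe_lt_coe, coe_nnnorm, NNReal.coe_one]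
    by_contra! h2
    exact absurd h1 (not_lt.2 (inv_le_one_of_one_le₀ h2))
  set A := ((U⁻¹ : (Matrix (Fin n) (Fin n) ℂ)ˣ) : Matrix (Fin n) (Fin n) ℂ)
  obtain ⟨r, hr1, hr2⟩ := ENNReal.lt_iff_exists_nnreal_btwn.1 hr
  have hr2' : r < 1 := by exact_mod_cast hr2
  have hev := (spectrum.pow_nnnorm_pow_one_div_tendsto_nhds_spectralRadius A).eventually_lt_const
    hr1
  have hA : Tendsto (fun k : ℕ => A ^ k) atTop (𝓝 0) := by
    refine squeeze_zero_norm' (a := fun k : ℕ => (r : ℝ) ^ k) ?_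
      (tendsto_pow_atTop_nhds_zero_of_lt_one r.2 (by exact_mod_cast hr2'))
    filter_upwards [hev, eventually_gt_atTop 0] with k hk hk0
    rw [one_div, ENNReal.rpow_inv_lt_iff (by exact_mod_cast hk0), ENNReal.rpow_natCast] at hk
    have : ‖A ^ k‖₊ < r ^ k := by exact_mod_cast hk
    exact_mod_cast this.le
  have hc : Continuous fun M : Matrix (Fin n) (Fin n) ℂ => M.mulVec v :=
    Continuous.matrix_mulVec continuous_id continuous_const
  simpa [Function.comp_def] using (hc.tendsto 0).comp hA

end

/-! ### Invariant convex sets are real subspaces -/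

/-- Suppose that a polynomial with nonnegative coefficients and positive constant term annihilates
`f`, and that every vector has `f`-preimages of high order close to zero. Then a nonempty convex
set mapped into itself by `f` is a linear subspace. -/
lemma span_eq_of_convex_of_mapsTo {V : Type*} [NormedAddCommGroup V] [NormedSpace ℝ V]
    [FiniteDimensional ℝ V] (f : V →ₗ[ℝ] V) {P : ℝ[X]} (hP : ∀ i, 0 ≤ P.coeff i)
    (hP0 : 0 < P.coeff 0)
    (hPf : ∀ x, ∑ i ∈ Finset.range (P.natDegree + 1), P.coeff i • (f ^ i) x = 0)
    (hf : ∀ w, ∃ u : ℕ → V, (∀ k, (f ^ k) (u k) = w) ∧ Tendsto u atTop (𝓝 0))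
    {S : Set V} (hne : S.Nonempty) (hconv : Convex ℝ S) (hmaps : Set.MapsTo f S S) :
    (Submodule.span ℝ S : Set V) = S := by
  have hpow : ∀ k : ℕ, ∀ x ∈ S, (f ^ k) x ∈ S := by
    intro k x hx
    rw [Module.End.pow_apply]
    exact hmaps.iterate k hx
  -- the annihilating polynomial, normalized, writes `0` as a convex combination of an orbit
  have hzero : (0 : V) ∈ S := by
    obtain ⟨x, hx⟩ := hne
    have hsum : 0 < ∑ i ∈ Finset.range (P.natDegree + 1), P.coeff i :=
      Finset.sum_pos' (fun i _ => hP i) ⟨0, by simp, hP0⟩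
    have := hconv.centerMass_mem (t := Finset.range (P.natDegree + 1)) (w := P.coeff)
      (z := fun i => (f ^ i) x) (fun i _ => hP i) hsum (fun i _ => hpow i x hx)
    simpa [Finset.centerMass, hPf] using this
  -- a small negative multiple of a point of `S` lies in `S`, by the same relation
  have hneg : ∀ x ∈ S, ∃ ε : ℝ, 0 < ε ∧ (-ε) • x ∈ S := by
    intro x hx
    set d := P.natDegree
    set s : ℝ := ∑ i ∈ Finset.range d, P.coeff (i + 1) with hs
    have hs0 : 0 ≤ s := Finset.sum_nonneg fun i _ => hP _
    have hrel : ∑ i ∈ Finset.range d, P.coeff (i + 1) • (f ^ (i + 1)) x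
        = -(P.coeff 0 • x) := by
      have h := hPf x
      rw [Finset.sum_range_succ'] at h
      simpa using eq_neg_of_add_eq_zero_left h
    obtain hs1 | hs1 := hs0.eq_or_lt
    · have hz : x = 0 := by
        have hc : ∀ i ∈ Finset.range d, P.coeff (i + 1) = 0 :=
          (Finset.sum_eq_zero_iff_of_nonneg fun i _ => hP _).1 (hs ▸ hs1.symm)
        rw [Finset.sum_eq_zero fun i hi => by rw [hc i hi, zero_smul]] at hrel
        simpa [hP0.ne'] using hrel.symm
      exact ⟨1, one_pos, by simpa [hz] using hzero⟩
    · refine ⟨s⁻¹ * P.coeff 0, by positivity, ?_⟩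
      have := hconv.centerMass_mem (t := Finset.range d) (w := fun i => P.coeff (i + 1))
        (z := fun i => (f ^ (i + 1)) x) (fun i _ => hP _) hs1 (fun i _ => hpow _ x hx)
      rw [Finset.centerMass, hrel, ← hs, smul_neg, smul_smul] at this
      rwa [neg_smul]
  -- the vectors that `S` absorbs form a subspace
  let W : Submodule ℝ V :=
    { carrier := {w | ∃ ε : ℝ, 0 < ε ∧ ε • w ∈ S ∧ (-ε) • w ∈ S}
      zero_mem' := ⟨1, one_pos, by simpa using hzero, by simpa using hzero⟩
      add_mem' := by
        rintro v w ⟨a, ha, hv, hv'⟩ ⟨b, hb, hw, hw'⟩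
        have key : ∀ p q : V, p ∈ S → q ∈ S → (b / (a + b)) • p + (a / (a + b)) • q ∈ S :=
          fun p q hp hq => hconv hp hq (by positivity) (by positivity) (by field_simp; ring)
        refine ⟨a * b / (a + b), by positivity, ?_, ?_⟩
        · convert key _ _ hv hw using 1
          rw [smul_add, smul_smul, smul_smul]
          congr 2 <;> ring
        · convert key _ _ hv' hw' using 1
          rw [smul_add, smul_smul, smul_smul]
          congr 2 <;> ring
      smul_mem' := by
        rintro c v ⟨a, ha, hv, hv'⟩
        obtain hc | rfl | hc := lt_trichotomy c 0
        · refine ⟨a / -c, div_pos ha (neg_pos.2 hc), ?_, ?_⟩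
          · rwa [smul_smul, div_neg, neg_mul, div_mul_cancel₀ _ hc.ne]
          · rwa [smul_smul, div_neg, neg_neg, div_mul_cancel₀ _ hc.ne]
        · exact ⟨1, one_pos, by simpa using hzero, by simpa using hzero⟩
        · refine ⟨a / c, div_pos ha hc, ?_, ?_⟩
          · rwa [smul_smul, div_mul_cancel₀ _ hc.ne']
          · rwa [smul_smul, neg_mul, div_mul_cancel₀ _ hc.ne'] }
  have hSW : S ⊆ W := by
    intro x hx
    obtain ⟨ε, hε, hx'⟩ := hneg x hx
    refine ⟨min ε 1, lt_min hε one_pos,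
      hconv.smul_mem_of_zero_mem hzero hx ⟨by positivity, min_le_right _ _⟩, ?_⟩
    have := hconv.smul_mem_of_zero_mem hzero hx' (t := min ε 1 / ε)
      ⟨by positivity, (div_le_one hε).2 (min_le_left _ _)⟩
    rwa [smul_smul, mul_neg, div_mul_cancel₀ _ hε.ne'] at this
  have hWf : ∀ w ∈ W, f w ∈ W := by
    rintro w ⟨ε, hε, h1, h2⟩
    exact ⟨ε, hε, by simpa using hmaps h1, by simpa using hmaps h2⟩
  suffices hWS : (W : Set V) ⊆ S from
    Set.Subset.antisymm ((SetLike.coe_subset_coe.2 (Submodule.span_le.2 hSW)).trans hWS)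
      Submodule.subset_span
  -- in finite dimension the absorbing convex set `S` contains a neighbourhood of `0` in `W`
  have hnhds : ∀ᶠ y : W in 𝓝 0, (y : V) ∈ S := by
    let b := Module.finBasis ℝ W
    set d := Module.finrank ℝ W
    have hb : ∀ i, ∃ ε : ℝ, 0 < ε ∧ ε • (b i : V) ∈ S ∧ (-ε) • (b i : V) ∈ S := fun i => (b i).2
    choose ε hε hpos hneg' using hb
    have hsmall : ∀ᶠ y : W in 𝓝 0, ∀ i, |b.repr y i| < ε i / (d + 1) := by
      refine eventually_all.2 fun i => ?_
      have hc : Continuous fun y : W => |b.repr y i| :=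
        (LinearMap.continuous_of_finiteDimensional (b.coord i)).abs
      refine (hc.tendsto 0).eventually_lt_const ?_
      have := hε i
      simp only [map_zero, Finsupp.coe_zero, Pi.zero_apply, abs_zero]
      positivity
    filter_upwards [hsmall] with y hy
    have hmem : ∀ i, (d * b.repr y i) • (b i : V) ∈ S := by
      intro i
      have h1 : |b.repr y i| * (d + 1) < ε i := (lt_div_iff₀ (by positivity)).1 (hy i)
      have h2 : |d * b.repr y i| ≤ ε i := by
        rw [abs_mul, Nat.abs_cast]
        linarith [abs_nonneg (b.repr y i)]
      have h3 := abs_le.1 h2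
      have hεi := hε i
      have := hconv (hneg' i) (hpos i) (a := (ε i - d * b.repr y i) / (2 * ε i))
        (b := (ε i + d * b.repr y i) / (2 * ε i)) (div_nonneg (by linarith) (by positivity))
        (div_nonneg (by linarith) (by positivity)) (by field_simp; ring)
      rw [smul_smul, smul_smul, ← add_smul] at this
      convert this using 2
      field_simp
      ring
    have hrepr : (y : V) = ∑ i, b.repr y i • (b i : V) := by
      have := congrArg W.subtype (b.sum_repr y)
      rw [map_sum] at this
      exact this.symm
    obtain hd | hd := Nat.eq_zero_or_pos d
    · have : IsEmpty (Fin d) := by rw [hd]; infer_instance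
      rw [hrepr, Finset.univ_eq_empty, Finset.sum_empty]
      exact hzero
    · have hd' : (d : ℝ) ≠ 0 := by positivity
      have := hconv.sum_mem (t := Finset.univ) (w := fun _ : Fin d => (d : ℝ)⁻¹)
        (z := fun i => (d * b.repr y i) • (b i : V)) (fun _ _ => by positivity)
        (by simp [hd']) (fun i _ => hmem i)
      simp only [smul_smul, inv_mul_cancel_left₀ hd'] at this
      rwa [hrepr]
  intro w hw
  obtain ⟨u, hu, hu0⟩ := hf w
  have hinj : Function.Injective f := by
    refine LinearMap.injective_iff_surjective.2 fun v => ?_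
    obtain ⟨u, hu, -⟩ := hf v
    exact ⟨u 1, by simpa using hu 1⟩
  -- the approximate preimages of `w` lie in `W`, because `f` is bijective on `W`
  have huW : ∀ k, u k ∈ W := by
    intro k
    have hginj : Function.Injective ((f.restrict hWf) ^ k) := by
      rw [Module.End.coe_pow]
      exact Function.Injective.iterate
        (fun x y hxy => Subtype.ext (hinj (congrArg Subtype.val hxy))) k
    obtain ⟨y, hy⟩ := LinearMap.injective_iff_surjective.1 hginj ⟨w, hw⟩
    have hyw : (f ^ k) (y : V) = w := by
      have := congrArg Subtype.val hy
      rwa [Module.End.pow_restrict, LinearMap.coe_restrict_apply] at this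
    have : (y : V) = u k := by
      have hk : Function.Injective (f ^ k) := by
        rw [Module.End.coe_pow]; exact hinj.iterate k
      exact hk (hyw.trans (hu k).symm)
    exact this ▸ y.2
  have hlim : Tendsto (fun k => (⟨u k, huW k⟩ : W)) atTop (𝓝 0) :=
    tendsto_subtype_rng.2 hu0
  obtain ⟨k, hk⟩ := (hlim.eventually hnhds).exists
  rw [← hu k]
  exact hpow k _ hk

/-- The matrix form of `span_eq_of_convex_of_mapsTo`, for `T` regarded as a real-linear map. -/
lemma IsInvariantClosedConvex.coe_span_eq {𝕜 : Type*} [RCLike 𝕜] {n : ℕ}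
    {T : Matrix (Fin n) (Fin n) 𝕜} {P : ℝ[X]} (hP : ∀ i, 0 ≤ P.coeff i) (hP0 : 0 < P.coeff 0)
    (hPT : aeval T P = 0) (hdet : IsUnit T.det)
    (hlim : ∀ v : Fin n → 𝕜, Tendsto (fun k : ℕ => (T⁻¹ ^ k).mulVec v) atTop (𝓝 0))
    {S : Set (Fin n → 𝕜)} (hS : IsInvariantClosedConvex T S) :
    (Submodule.span ℝ S : Set (Fin n → 𝕜)) = S := by
  have : FiniteDimensional ℝ 𝕜 := inferInstance
  have hpow : ∀ (k : ℕ) (x : Fin n → 𝕜),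
      ((T.mulVecLin.restrictScalars ℝ) ^ k) x = (T ^ k).mulVec x := by
    intro k x
    induction k with
    | zero => simp
    | succ k ih =>
      rw [pow_succ', Module.End.mul_apply, ih, pow_succ', ← Matrix.mulVec_mulVec]
      rfl
  refine span_eq_of_convex_of_mapsTo (T.mulVecLin.restrictScalars ℝ) hP hP0 (fun x => ?_)
    (fun w => ⟨fun k => (T⁻¹ ^ k).mulVec w, fun k => ?_, hlim w⟩) hS.1 hS.2.2.1 hS.2.2.2
  · have h := congrArg (fun M : Matrix (Fin n) (Fin n) 𝕜 => M.mulVec x) hPT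
    simp only [aeval_eq_sum_range, Matrix.sum_mulVec, Matrix.smul_mulVec,
      Matrix.zero_mulVec] at h
    simpa only [hpow] using h
  · have h1 : T ^ k * T⁻¹ ^ k = 1 := by
      rw [Matrix.inv_pow']
      exact Matrix.mul_nonsing_inv _ (by rw [Matrix.det_pow]; exact hdet.pow k)
    rw [hpow, Matrix.mulVec_mulVec, h1, Matrix.one_mulVec]

lemma isUnit_det_of_forall_mem_spectrum {n : ℕ} {T : Matrix (Fin n) (Fin n) ℂ}
    (h0 : ∀ z ∈ spectrum ℂ T, z ≠ 0) : IsUnit T.det := by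
  rw [← Matrix.isUnit_iff_isUnit_det, ← spectrum.zero_notMem_iff ℂ]
  exact fun h => h0 0 h rfl

/-! ### Multiplication by `I` as a real polynomial in the matrix -/

/-- If no two eigenvalues of `T` are conjugate, the characteristic polynomial `χ` is coprime to
its conjugate. The real polynomial `p` comes from symmetrizing, under conjugation, a polynomial
congruent to `I / 2` modulo `χ` and to `-I / 2` modulo the conjugate of `χ`. -/
lemma exists_aeval_eq_I {n : ℕ} {T : Matrix (Fin n) (Fin n) ℂ}
    (hT : ∀ μ ∈ spectrum ℂ T, ∀ ν ∈ spectrum ℂ T, μ ≠ (starRingEnd ℂ) ν) :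
    ∃ p : ℝ[X], aeval T p = algebraMap ℂ _ Complex.I := by
  let conj : ℂ →+* ℂ := starRingEnd ℂ
  have hcc : conj.comp conj = RingHom.id ℂ := by ext z; exact Complex.conj_conj z
  set q := T.charpoly with hq
  have hcop : IsCoprime q (q.map conj) := by
    rw [Polynomial.isCoprime_iff_aeval_ne_zero_of_isAlgClosed ℂ ℂ]
    intro z
    by_contra! h
    obtain ⟨h1, h2⟩ := h
    rw [coe_aeval_eq_eval] at h1 h2
    have h3 : eval (conj z) q = 0 := by
      have := congrArg conj h2
      rwa [map_zero, ← eval_map_apply, Polynomial.map_map, hcc, Polynomial.map_id] at this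
    exact hT z (Matrix.mem_spectrum_iff_isRoot_charpoly.2 h1) (conj z)
      (Matrix.mem_spectrum_iff_isRoot_charpoly.2 h3) (Complex.conj_conj z).symm
  obtain ⟨a, b, hab⟩ := hcop
  have hab' : a.map conj * q.map conj + b.map conj * q = 1 := by
    have := congrArg (Polynomial.map conj) hab
    simpa [Polynomial.map_map, hcc] using this
  let u : ℂ[X] := C (Complex.I / 2) * (1 - 2 * (a * q))
  have hlift : u + u.map conj ∈ lifts (algebraMap ℝ ℂ) := by
    rw [lifts_iff_coeff_lifts]
    intro k
    refine ⟨2 * (u.coeff k).re, ?_⟩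
    rw [coeff_add, coeff_map]
    exact (Complex.add_conj _).symm
  obtain ⟨p, hp⟩ := (mem_lifts _).1 hlift
  refine ⟨p, ?_⟩
  have hI : conj (Complex.I / 2) = -(Complex.I / 2) := by
    rw [map_div₀, Complex.conj_I, map_ofNat, neg_div]
  have hu : u + u.map conj = C Complex.I - C Complex.I * (a + b.map conj) * q := by
    have h1 : a.map conj * q.map conj = 1 - b.map conj * q := eq_sub_of_add_eq hab'
    have h2 : (C Complex.I : ℂ[X]) = 2 * C (Complex.I / 2) := by
      rw [← C_ofNat, ← C_mul]; congr 1; ring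
    simp only [u, Polynomial.map_mul, Polynomial.map_sub, Polynomial.map_one, map_C, hI,
      Polynomial.map_ofNat, h1, C_neg]
    rw [h2]
    ring
  rw [← aeval_map_algebraMap ℂ, hp, hu, map_sub, aeval_C, map_mul, hq,
    Matrix.aeval_self_charpoly, mul_zero, sub_zero]

lemma mulVec_aeval_mem {𝕜 : Type*} [RCLike 𝕜] {n : ℕ} {T : Matrix (Fin n) (Fin n) 𝕜}
    {M : Submodule ℝ (Fin n → 𝕜)} (hM : ∀ x ∈ M, T.mulVec x ∈ M) (p : ℝ[X])
    {x : Fin n → 𝕜} (hx : x ∈ M) : (aeval T p).mulVec x ∈ M := by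
  have hpow : ∀ k : ℕ, (T ^ k).mulVec x ∈ M := by
    intro k
    induction k with
    | zero => simpa using hx
    | succ k ih => rw [pow_succ', ← Matrix.mulVec_mulVec]; exact hM _ ih
  simp only [aeval_eq_sum_range, Matrix.sum_mulVec, Matrix.smul_mulVec]
  exact M.sum_mem fun i _ => M.smul_mem _ (hpow i)

/-- A real subspace closed under multiplication by `I` is a complex subspace. -/
lemma exists_complex_submodule_coe_eq {V : Type*} [AddCommGroup V] [Module ℂ V]
    (M : Submodule ℝ V) (hI : ∀ x ∈ M, Complex.I • x ∈ M) :
    ∃ N : Submodule ℂ V, (N : Set V) = M :=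
  ⟨{ M.toAddSubmonoid with
      smul_mem' := fun z x hx => by
        have : z • x = z.re • x + z.im • (Complex.I • x) := by
          conv_lhs => rw [← Complex.re_add_im z]
          rw [add_smul, mul_smul, Complex.coe_smul, Complex.coe_smul]
        rw [this]
        exact M.add_mem (M.smul_mem _ hx) (M.smul_mem _ (hI x hx)) }, rfl⟩

/-! ### Invariant convex sets from forbidden eigenvalues -/

/-- The image of the closed unit disc under a nonzero real-linear map that intertwines
multiplication by `μ` with `T` is a bounded invariant convex set other than `{0}`. -/
lemma exists_not_isInvariantSubspace_of_norm_le_one {𝕜 : Type*} [RCLike 𝕜] {n : ℕ}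
    {T : Matrix (Fin n) (Fin n) 𝕜} (φ : ℂ →ₗ[ℝ] (Fin n → 𝕜)) {μ : ℂ}
    (hφ : ∀ z, T.mulVec (φ z) = φ (μ * z)) (hμ : ‖μ‖ ≤ 1) {z₀ : ℂ} (hz₀ : φ z₀ ≠ 0) :
    ∃ S, IsInvariantClosedConvex T S ∧ ¬ IsInvariantSubspace T S := by
  have hcpt : IsCompact (φ '' Metric.closedBall 0 1) :=
    (isCompact_closedBall 0 1).image (LinearMap.continuous_of_finiteDimensional φ)
  refine ⟨φ '' Metric.closedBall 0 1, ⟨⟨0, 0, by simp, by simp⟩, hcpt.isClosed,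
    (convex_closedBall 0 1).linear_image φ, ?_⟩, ?_⟩
  · rintro _ ⟨z, hz, rfl⟩
    refine ⟨μ * z, ?_, (hφ z).symm⟩
    rw [mem_closedBall_zero_iff] at hz ⊢
    rw [norm_mul]
    exact mul_le_one₀ hμ (norm_nonneg _) hz
  · rintro ⟨⟨M, hM⟩, -⟩
    obtain ⟨R, hR⟩ := hcpt.isBounded.exists_norm_le
    rw [← hM] at hR
    have hz : z₀ ≠ 0 := by rintro rfl; simp at hz₀
    have hmem : φ (‖z₀‖⁻¹ • z₀) ∈ M := by
      rw [← SetLike.mem_coe, hM]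
      refine ⟨_, ?_, rfl⟩
      rw [mem_closedBall_zero_iff, norm_smul, norm_inv, norm_norm,
        inv_mul_cancel₀ (norm_ne_zero_iff.2 hz)]
    have hne : φ (‖z₀‖⁻¹ • z₀) ≠ 0 := by
      rw [map_smul]
      exact smul_ne_zero (inv_ne_zero (norm_ne_zero_iff.2 hz)) hz₀
    obtain ⟨c, hc⟩ := NormedField.exists_lt_norm 𝕜 (R / ‖φ (‖z₀‖⁻¹ • z₀)‖)
    have h1 := hR _ (M.smul_mem c hmem)
    rw [norm_smul] at h1
    exact absurd h1 (not_le.2 ((div_lt_iff₀ (norm_pos_iff.2 hne)).1 hc))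

/-- An invariant real subspace that is not closed under `I` is an invariant closed convex
set, but not an invariant complex subspace. -/
lemma exists_not_isInvariantSubspace_of_I_smul_notMem {n : ℕ}
    {T : Matrix (Fin n) (Fin n) ℂ} (M : Submodule ℝ (Fin n → ℂ))
    (hM : ∀ x ∈ M, T.mulVec x ∈ M) {x : Fin n → ℂ} (hx : x ∈ M) (hIx : Complex.I • x ∉ M) :
    ∃ S, IsInvariantClosedConvex T S ∧ ¬ IsInvariantSubspace T S := by
  refine ⟨M, ⟨⟨0, M.zero_mem⟩, M.closed_of_finiteDimensional, M.convex, hM⟩, ?_⟩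
  rintro ⟨⟨N, hN⟩, -⟩
  refine hIx ?_
  rw [← SetLike.mem_coe, ← hN] at hx ⊢
  exact N.smul_mem _ hx

/-- Necessity over `ℂ`: discs in eigenlines exclude `‖μ‖ ≤ 1`, real lines exclude real
eigenvalues, and the real planes `{z • v + conj z • w}` exclude pairs of conjugate eigenvalues. -/
lemma complex_eigenvalue_conditions {n : ℕ} {T : Matrix (Fin n) (Fin n) ℂ}
    (h : ∀ S, IsInvariantClosedConvex T S → IsInvariantSubspace T S) :
    (∀ μ : ℂ, IsEigenvalueOf T μ →
        μ ∈ (Metric.closedBall (0 : ℂ) 1 ∪ Set.range (fun r : ℝ => (r : ℂ)))ᶜ) ∧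
      ∀ μ ν : ℂ, IsEigenvalueOf T μ → IsEigenvalueOf T ν → μ ≠ (starRingEnd ℂ) ν := by
  have hnot : ¬ ∃ S, IsInvariantClosedConvex T S ∧ ¬ IsInvariantSubspace T S :=
    fun ⟨S, h1, h2⟩ => h2 (h S h1)
  have hreal : ∀ r : ℝ, ¬ IsEigenvalueOf T r := by
    intro r hr
    obtain ⟨v, hv, hv0⟩ := Module.End.HasEigenvalue.exists_hasEigenvector hr
    have hTv : T.mulVec v = (r : ℂ) • v := by
      simpa using Module.End.mem_eigenspace_iff.1 hv
    refine hnot (exists_not_isInvariantSubspace_of_I_smul_notMem (Submodule.span ℝ {v}) ?_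
      (Submodule.mem_span_singleton_self v) ?_)
    · intro x hx
      obtain ⟨t, rfl⟩ := Submodule.mem_span_singleton.1 hx
      rw [Matrix.mulVec_smul, hTv, Complex.coe_smul]
      exact Submodule.smul_mem _ _ (Submodule.smul_mem _ _ (Submodule.mem_span_singleton_self v))
    · intro hx
      obtain ⟨t, ht⟩ := Submodule.mem_span_singleton.1 hx
      rw [← Complex.coe_smul] at ht
      have := congrArg Complex.im (smul_left_injective ℂ hv0 ht)
      simp at this
  refine ⟨fun μ hμ => ?_, fun μ ν hμ hν hμν => ?_⟩
  · rintro (hμ1 | ⟨r, rfl⟩)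
    · obtain ⟨v, hv, hv0⟩ := Module.End.HasEigenvalue.exists_hasEigenvector hμ
      have hTv : T.mulVec v = μ • v := by
        simpa using Module.End.mem_eigenspace_iff.1 hv
      refine hnot (exists_not_isInvariantSubspace_of_norm_le_one
        ((LinearMap.toSpanSingleton ℂ (Fin n → ℂ) v).restrictScalars ℝ) (μ := μ) (z₀ := 1)
        (fun z => ?_) (mem_closedBall_zero_iff.1 hμ1) (by simpa using hv0))
      simp only [LinearMap.restrictScalars_apply, LinearMap.toSpanSingleton_apply,
        Matrix.mulVec_smul, hTv, smul_smul, mul_comm]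
    · exact hreal r hμ
  · by_cases hne : μ = ν
    · subst hne
      obtain ⟨r, rfl⟩ := Complex.conj_eq_iff_real.1 hμν.symm
      exact hreal r hμ
    obtain ⟨v, hv⟩ := Module.End.HasEigenvalue.exists_hasEigenvector hμ
    obtain ⟨w, hw⟩ := Module.End.HasEigenvalue.exists_hasEigenvector hν
    have hTv : T.mulVec v = μ • v := by
      simpa using Module.End.mem_eigenspace_iff.1 hv.1
    have hTw : T.mulVec w = ν • w := by
      simpa using Module.End.mem_eigenspace_iff.1 hw.1
    have hind : ∀ a b : ℂ, a • v + b • w = 0 → a = 0 := by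
      intro a b hab
      have h1 : (a * μ) • v + (b * ν) • w = 0 := by
        have := congrArg T.mulVec hab
        simpa [Matrix.mulVec_add, Matrix.mulVec_smul, hTv, hTw, smul_smul] using this
      have h2 : (a * (μ - ν)) • v = 0 := by
        have h3 : (a * (μ - ν)) • v
            = ((a * μ) • v + (b * ν) • w) - ν • (a • v + b • w) := by module
        rw [h3, h1, hab, smul_zero, sub_zero]
      exact (mul_eq_zero.1 ((smul_eq_zero.1 h2).resolve_right hv.2)).resolve_right
        (sub_ne_zero.2 hne)
    let φ : ℂ →ₗ[ℝ] (Fin n → ℂ) :=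
      { toFun := fun z => z • v + (starRingEnd ℂ) z • w
        map_add' := fun y z => by rw [map_add]; module
        map_smul' := fun t z => by
          rw [← Complex.coe_smul, ← Complex.coe_smul, smul_eq_mul, map_mul, Complex.conj_ofReal,
            RingHom.id_apply, smul_add, smul_smul, smul_smul] }
    refine hnot (exists_not_isInvariantSubspace_of_I_smul_notMem (LinearMap.range φ) ?_
      (LinearMap.mem_range_self φ 1) ?_)
    · rintro _ ⟨z, rfl⟩
      refine ⟨μ * z, ?_⟩
      simp only [φ, LinearMap.coe_mk, AddHom.coe_mk, Matrix.mulVec_add, Matrix.mulVec_smul, hTv,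
        hTw, smul_smul, map_mul, hμν, Complex.conj_conj, mul_comm]
    · rintro ⟨z, hz⟩
      have hz' : z • v + (starRingEnd ℂ) z • w = Complex.I • ((1 : ℂ) • v + (1 : ℂ) • w) := by
        simpa [φ] using hz
      have h1 := hind (z - Complex.I) ((starRingEnd ℂ) z - Complex.I) (by
        rw [sub_smul, sub_smul, sub_add_sub_comm, hz']; module)
      have hzI : z = Complex.I := sub_eq_zero.1 h1
      subst hzI
      -- with `z = I` the relation says `-I • w = I • w`
      have h2 : (2 * Complex.I) • w = 0 := by
        rw [Complex.conj_I] at hz'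
        have : (2 * Complex.I) • w = Complex.I • ((1 : ℂ) • v + (1 : ℂ) • w)
            - (Complex.I • v + (-Complex.I) • w) := by module
        rw [this, hz', sub_self]
      exact hw.2 ((smul_eq_zero.1 h2).resolve_left (by simp))

/-- Necessity over `ℝ`: for an eigenvector `v` of the complexification, `z ↦ Re (z • v)`
intertwines multiplication by `μ` with `T`. Its image of the unit disc excludes `‖μ‖ ≤ 1`, and
a ray in its range excludes `μ > 0`. -/
lemma real_eigenvalue_conditions {n : ℕ} {T : Matrix (Fin n) (Fin n) ℝ}
    (h : ∀ S, IsInvariantClosedConvex T S → IsInvariantSubspace T S) (μ : ℂ)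
    (hμ : IsEigenvalueOf (T.map (fun r : ℝ => (r : ℂ))) μ) :
    μ ∈ (Metric.closedBall (0 : ℂ) 1 ∪ (fun r : ℝ => (r : ℂ)) '' Set.Ioi 0)ᶜ := by
  have hnot : ¬ ∃ S, IsInvariantClosedConvex T S ∧ ¬ IsInvariantSubspace T S :=
    fun ⟨S, h1, h2⟩ => h2 (h S h1)
  obtain ⟨v, hv, hv0⟩ := Module.End.HasEigenvalue.exists_hasEigenvector hμ
  have hTv : (T.map (fun r : ℝ => (r : ℂ))).mulVec v = μ • v := by
    simpa using Module.End.mem_eigenspace_iff.1 hv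
  let φ : ℂ →ₗ[ℝ] (Fin n → ℝ) :=
    LinearMap.pi fun i => Complex.reLm ∘ₗ LinearMap.mulRight ℝ (v i)
  have hφ_apply : ∀ z i, φ z i = (z * v i).re := fun z i => rfl
  have hφ : ∀ z, T.mulVec (φ z) = φ (μ * z) := by
    intro z
    ext i
    have h1 : ∑ j, (T i j : ℂ) * v j = μ * v i := by
      simpa [Matrix.mulVec, dotProduct] using congrFun hTv i
    rw [hφ_apply, mul_comm μ z, mul_assoc, ← h1, Finset.mul_sum, Complex.re_sum]
    simp only [Matrix.mulVec, dotProduct, hφ_apply]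
    refine Finset.sum_congr rfl fun j _ => ?_
    rw [mul_left_comm, Complex.re_ofReal_mul]
  obtain ⟨z₀, hz₀⟩ : ∃ z, φ z ≠ 0 := by
    obtain ⟨i, hi⟩ := Function.ne_iff.1 hv0
    refine ⟨(v i)⁻¹, fun hz => ?_⟩
    have := congrFun hz i
    rw [hφ_apply, inv_mul_cancel₀ hi] at this
    simp at this
  rintro (hμ1 | ⟨r, hr, rfl⟩)
  · exact hnot (exists_not_isInvariantSubspace_of_norm_le_one φ hφ
      (mem_closedBall_zero_iff.1 hμ1) hz₀)
  · have hr0 : (0 : ℝ) < r := hr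
    have hTφ : T.mulVec (φ z₀) = r • φ z₀ := by
      rw [hφ, ← map_smul, Complex.real_smul]
    let ψ := LinearMap.toSpanSingleton ℝ (Fin n → ℝ) (φ z₀)
    refine hnot ⟨ψ '' Set.Ici 0, ⟨⟨0, 0, by simp, by simp⟩, ?_,
      (convex_Ici 0).linear_image ψ, ?_⟩, ?_⟩
    · exact (LinearMap.isClosedEmbedding_of_injective
        (LinearMap.ker_toSpanSingleton ℝ hz₀)).isClosedMap _ isClosed_Ici
    · rintro _ ⟨t, ht, rfl⟩
      refine ⟨t * r, mul_nonneg ht hr0.le, ?_⟩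
      simp only [ψ, LinearMap.toSpanSingleton_apply, Matrix.mulVec_smul, hTφ, smul_smul]
    · rintro ⟨⟨M, hM⟩, -⟩
      have h1 : φ z₀ ∈ M := by
        rw [← SetLike.mem_coe, hM]
        exact ⟨1, zero_le_one' ℝ, by simp [ψ]⟩
      have h2 := M.neg_mem h1
      rw [← SetLike.mem_coe, hM] at h2
      obtain ⟨t, ht, hte⟩ := h2
      have h3 : (t + 1) • φ z₀ = 0 := by
        rw [add_smul, one_smul]
        exact add_eq_zero_iff_eq_neg.2 hte
      have h4 := (smul_eq_zero.1 h3).resolve_right hz₀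
      have h5 : (0 : ℝ) ≤ t := ht
      linarith

/-! ### The characterization -/

theorem theoremT :
    (∀ (n : ℕ) (T : Matrix (Fin n) (Fin n) ℂ),
      (∀ C : Set (Fin n → ℂ), IsInvariantClosedConvex T C → IsInvariantSubspace T C) ↔
        ((∀ μ : ℂ, IsEigenvalueOf T μ →
            μ ∈ (Metric.closedBall (0 : ℂ) 1 ∪ Set.range (fun r : ℝ => (r : ℂ)))ᶜ) ∧
          ∀ μ ν : ℂ, IsEigenvalueOf T μ → IsEigenvalueOf T ν →
            μ ≠ (starRingEnd ℂ) ν)) ∧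
    (∀ (n : ℕ) (T : Matrix (Fin n) (Fin n) ℝ),
      (∀ C : Set (Fin n → ℝ), IsInvariantClosedConvex T C → IsInvariantSubspace T C) ↔
        ∀ μ : ℂ, IsEigenvalueOf (T.map (fun r : ℝ => (r : ℂ))) μ →
          μ ∈ (Metric.closedBall (0 : ℂ) 1 ∪ (fun r : ℝ => (r : ℂ)) '' Set.Ioi 0)ᶜ) := by
  refine ⟨fun n T => ⟨complex_eigenvalue_conditions, ?_⟩,
    fun n T => ⟨real_eigenvalue_conditions, ?_⟩⟩
  · rintro ⟨h1, h2⟩ S hS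
    simp only [isEigenvalueOf_iff_mem_spectrum] at h1 h2
    have hnorm : ∀ z ∈ spectrum ℂ T, 1 < ‖z‖ := fun z hz =>
      not_le.1 fun hle => h1 z hz (Or.inl (mem_closedBall_zero_iff.2 hle))
    have h0 : ∀ z ∈ spectrum ℂ T, z ≠ 0 := fun z hz =>
      norm_pos_iff.1 (zero_lt_one.trans (hnorm z hz))
    obtain ⟨P, hP, hP0, hPT⟩ := exists_nonneg_coeff_aeval_eq_zero h0
      (fun z hz r _ hr => h1 z hz (Or.inr ⟨r, hr⟩))
    have hspan := hS.coe_span_eq hP hP0 hPT (isUnit_det_of_forall_mem_spectrum h0)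
      (tendsto_inv_pow_mulVec hnorm)
    obtain ⟨p, hp⟩ := exists_aeval_eq_I fun μ hμ ν hν => h2 μ ν hμ hν
    have hmaps : ∀ x ∈ Submodule.span ℝ S, T.mulVec x ∈ Submodule.span ℝ S := by
      intro x hx
      rw [← SetLike.mem_coe, hspan] at hx ⊢
      exact hS.2.2.2 hx
    obtain ⟨N, hN⟩ := exists_complex_submodule_coe_eq (Submodule.span ℝ S) fun x hx => by
      have := mulVec_aeval_mem hmaps p hx
      rwa [hp, Algebra.algebraMap_eq_smul_one, Matrix.smul_mulVec, Matrix.one_mulVec] at this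
    exact ⟨⟨N, hN.trans hspan⟩, hS.2.2.2⟩
  · intro h1 S hS
    simp only [isEigenvalueOf_iff_mem_spectrum] at h1
    set A : Matrix (Fin n) (Fin n) ℂ := T.map (fun r : ℝ => (r : ℂ)) with hA
    have hnorm : ∀ z ∈ spectrum ℂ A, 1 < ‖z‖ := fun z hz =>
      not_le.1 fun hle => h1 z hz (Or.inl (mem_closedBall_zero_iff.2 hle))
    have h0 : ∀ z ∈ spectrum ℂ A, z ≠ 0 := fun z hz =>
      norm_pos_iff.1 (zero_lt_one.trans (hnorm z hz))
    obtain ⟨P, hP, hP0, hPA⟩ := exists_nonneg_coeff_aeval_eq_zero h0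
      (fun z hz r hr0 hr => h1 z hz (Or.inr ⟨r, hr0, hr⟩))
    let ι : Matrix (Fin n) (Fin n) ℝ →ₐ[ℝ] Matrix (Fin n) (Fin n) ℂ := Complex.ofRealAm.mapMatrix
    have hι : ∀ M, ι M = M.map (fun r : ℝ => (r : ℂ)) := fun M => rfl
    have hιinj : Function.Injective ι := Matrix.map_injective Complex.ofReal_injective
    have hPT : aeval T P = 0 := hιinj (by rw [← aeval_algHom_apply, map_zero]; exact hPA)
    have hAdet : A.det = (T.det : ℂ) := (RingHom.map_det Complex.ofRealHom T).symm
    have hdet : IsUnit T.det := by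
      have := isUnit_det_of_forall_mem_spectrum h0
      rw [isUnit_iff_ne_zero, hAdet] at this
      exact isUnit_iff_ne_zero.2 (by exact_mod_cast this)
    have hinv : ι T⁻¹ = A⁻¹ := by
      refine (Matrix.inv_eq_right_inv ?_).symm
      have := congrArg ι (Matrix.mul_nonsing_inv T hdet)
      rwa [map_mul, map_one] at this
    have hlim : ∀ v : Fin n → ℝ, Tendsto (fun k : ℕ => (T⁻¹ ^ k).mulVec v) atTop (𝓝 0) := by
      intro v
      have hcomplex := tendsto_inv_pow_mulVec hnorm fun i => (v i : ℂ)
      rw [tendsto_pi_nhds] at hcomplex ⊢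
      intro i
      have hre := (Complex.continuous_re.tendsto _).comp (hcomplex i)
      refine hre.congr fun k => ?_
      simp only [Function.comp_apply]
      rw [← hinv, ← map_pow ι, hι]
      simp [Matrix.mulVec, dotProduct]
    have hspan := hS.coe_span_eq hP hP0 hPT hdet hlim
    exact ⟨⟨Submodule.span ℝ S, hspan⟩, hS.2.2.2⟩
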